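/- Conventions. Algebras are sets (possibly empty) with finitary operations. A uniformity on a set $S$ is a filter $\mathcal U$ of reflexive binary relations on $S$ that is closed under $R\mapsto R^{-1}$ and such that every $R\in\mathcal U$ contains $V\circ V$ for some $V\in\mathcal U$. A uniformity $\mathcal U$ on an algebra $A$ is compatible if for every basic operation $\omega$ and every $R\in\mathcal U$ there is $\bar R\in\mathcal U$ such that $(\omega(\mathbf x),\omega(\mathbf y))\in R$ whenever $(x_i,y_i)\in\bar R$ for all $i$. The set $\operatorname{Unif}A$ of compatible uniformities on $A$, ordered by $\mathcal U\le\mathcal V\iff\mathcal U\supseteq\mathcal V$, is a complete lattice. A congruence $\alpha\in\operatorname{Con}A$ is identified with the compatible uniformity of all relations containing $\alpha$. For a homomorphism $f:A\to B$ and $\mathcal V\in\operatorname{Unif}B$, $f^{-1}(\mathcal V)\in\operatorname{Unif}A$ is the uniformity with base $\{(f\times f)^{-1}(V): V\in\mathcal V\}$; for $\mathcal U\in\operatorname{Unif}A$, $f_{*c}(\mathcal U)\in\operatorname{Unif}B$ is the meet of all $\mathcal V\in\operatorname{Unif}B$ with $\mathcal U\le f^{-1}(\mathcal V)$. For $\mathcal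 U,\mathcal V,\mathcal W\in\operatorname{Unif}A$, $C(\mathcal U,\mathcal V;\mathcal W)$ means: for all $n,n'\ge0$, every $(n+n')$-ary term $t$ and every $R\in\mathcal W$ there are $P\in\mathcal U$, $Q\in\mathcal V$, $\bar R\in\mathcal W$ such that, for all $\mathbf a,\mathbf a'\in A^n$ and $\mathbf b,\mathbf c\in A^{n'}$ with $(a_i,a_i')\in P$ and $(b_j,c_j)\in Q$ for all $i,j$, $(t(\mathbf a,\mathbf b),t(\mathbf a,\mathbf c))\in\bar R$ implies $(t(\mathbf a',\mathbf b),t(\mathbf a',\mathbf c))\in R$. Let $[\mathcal U,\mathcal V]$ be the least $\mathcal W\in\operatorname{Unif}A$ with $C(\mathcal U,\mathcal V;\mathcal W)$. For $\alpha\in\operatorname{Con}A$ let $A(\alpha)$ be the subalgebra $\{(a,b): a\mathrel\alpha b\}$ of $A\times A$, with projections $\pi:(a,b)\mapsto a$ and $\pi':(a,b)\mapsto b$ to $A$ and diagonal homomorphism $\Delta_\alpha:A\to A(\alpha)$, $a\mapsto(a,a)$. For $\mathcal U\in\operatorname{Unif}A$ put $\Delta_{\alpha,\mathcal U}=(\Delta_\alpha)_{*c}(\mathcal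 U)$, and let $[\alpha,\mathcal U]'$ be the unique element of $\operatorname{Unif}A$ such that $$(\pi')^{-1}([\alpha,\mathcal U]')=(\Delta_{\alpha,\mathcal U}\wedge\ker\pi)\vee\ker\pi'$$ in $\operatorname{Unif}A(\alpha)$. Theorem. Let $A$ be an algebra, $\alpha\in\operatorname{Con}A$ and $\mathcal U\in\operatorname{Unif}A$. If $A$ belongs to a congruence-modular variety, then $[\alpha,\mathcal U]\le[\alpha,\mathcal U]'$. If $A$ has an underlying group structure, that is, if there is a group structure on the set $A$ whose multiplication and inversion are term operations of $A$, then $[\alpha,\mathcal U]=[\alpha,\mathcal U]'$. -/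

import Mathlib

universe u v w

namespace UnifComm

open Filter Set
open scoped Uniformity FirstOrder

section Congruences

variable (L : FirstOrder.Language.{v, w}) (A : Type u) [L.Structure A]

/-- A congruence of the algebra `A`: an equivalence relation preserved by the basic operations. -/
structure Congruence extends Setoid A where
  compat : ∀ {n : ℕ} (f : L.Functions n) (x y : Fin n → A), (∀ i, toSetoid.r (x i) (y i)) →
    toSetoid.r (FirstOrder.Language.Structure.funMap f x) (FirstOrder.Language.Structure.funMap f y)

variable {L A}

namespace Congruence

/-- Congruences are ordered by inclusion. -/
instance : PartialOrder (Congruence L A) :=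
  PartialOrder.lift Congruence.toSetoid (fun a b h => by
    cases a; cases b; cases h; rfl)

instance : InfSet (Congruence L A) where
  sInf S :=
    { toSetoid := sInf (Congruence.toSetoid '' S)
      compat := by
        intro n f x y h s hs
        obtain ⟨c, hc, rfl⟩ := hs
        exact c.compat f x y fun i => h i _ ⟨c, hc, rfl⟩ }

theorem isGLB_sInf (S : Set (Congruence L A)) : IsGLB S (sInf S) :=
  ⟨fun c hc => show sInf (Congruence.toSetoid '' S) ≤ c.toSetoid from sInf_le ⟨c, hc, rfl⟩,
    fun c hc => show c.toSetoid ≤ sInf (Congruence.toSetoid '' S) from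
      le_sInf (by rintro _ ⟨d, hd, rfl⟩; exact hc hd)⟩

/-- The lattice `Con A` of congruences of `A`. -/
instance : CompleteLattice (Congruence L A) := completeLatticeOfInf _ isGLB_sInf

/-- The underlying binary relation of a congruence, as a set of pairs. -/
def graph (α : Congruence L A) : Set (A × A) := {p | α.r p.1 p.2}

/-- The kernel of a homomorphism. -/
def ker {B : Type*} [L.Structure B] (f : A →[L] B) : Congruence L A where
  toSetoid := Setoid.ker f
  compat := by
    intro n g x y h
    change f _ = f _
    rw [f.map_fun, f.map_fun]
    exact congrArg _ (funext h)

end Congruence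

end Congruences

section Varieties

/-- `A` satisfies all the identities in `E`. -/
def Satisfies {L : FirstOrder.Language.{v, w}} (E : Set (L.Term ℕ × L.Term ℕ))
    (A : Type u) [L.Structure A] : Prop :=
  ∀ e ∈ E, ∀ x : ℕ → A, e.1.realize x = e.2.realize x

/-- The variety of algebras defined by the identities `E` is congruence-modular. -/
def CongruenceModular {L : FirstOrder.Language.{v, w}} (E : Set (L.Term ℕ × L.Term ℕ)) : Prop :=
  ∀ (B : Type u) [L.Structure B], Satisfies E B → IsModularLattice (Congruence L B)

/-- `A` belongs to some congruence-modular variety. -/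
def InCongruenceModularVariety (L : FirstOrder.Language.{v, w}) (A : Type u) [L.Structure A] : Prop :=
  ∃ E : Set (L.Term ℕ × L.Term ℕ), Satisfies E A ∧ CongruenceModular.{u} E

/-- `A` has an underlying group structure: there is a group structure on the set `A` whose
multiplication and inversion are term operations of the algebra `A`. -/
def HasUnderlyingGroup (L : FirstOrder.Language.{v, w}) (A : Type u) [L.Structure A] : Prop :=
  ∃ _ : Group A,
    (∃ m : L.Term (Fin 2), ∀ x y : A, m.realize ![x, y] = x * y) ∧
    (∃ i : L.Term (Fin 1), ∀ x : A, i.realize ![x] = x⁻¹)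

end Varieties

section Uniformities

variable (L : FirstOrder.Language.{v, w}) (A : Type u) [L.Structure A]

/-- A uniformity on the set `A` is compatible if for every entourage `V` and every basic
operation `f` there is an entourage `V'` with `f(V') ⊆ V`. -/
def IsCompatible (U : UniformSpace A) : Prop :=
  ∀ {n : ℕ} (f : L.Functions n), ∀ V ∈ 𝓤[U], ∃ V' ∈ 𝓤[U], ∀ x y : Fin n → A,
    (∀ i, (x i, y i) ∈ V') →
      (FirstOrder.Language.Structure.funMap f x, FirstOrder.Language.Structure.funMap f y) ∈ V

/-- The compatible uniformities on the algebra `A`. -/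
structure CompUnif where
  unif : UniformSpace A
  compat : IsCompatible L A unif

variable {L A}

namespace CompUnif

/-- The entourages of a compatible uniformity. -/
def ent (U : CompUnif L A) : Filter (A × A) := 𝓤[U.unif]

theorem ext_ent {U V : CompUnif L A} (h : U.ent = V.ent) : U = V := by
  cases U; cases V
  congr
  exact UniformSpace.ext h

/-- Compatible uniformities are ordered as filters are, that is, by reverse inclusion:
`U ≤ V` if and only if every entourage of `V` is an entourage of `U`. -/
instance : PartialOrder (CompUnif L A) :=
  PartialOrder.lift ent (fun _ _ h => ext_ent h)

theorem isCompatible_sInf (S : Set (CompUnif L A)) : IsCompatible L A (sInf (unif '' S)) := by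
  intro n f
  let G : Filter (A × A) :=
    { sets := {V | ∃ V' ∈ 𝓤[sInf (unif '' S)], ∀ x y : Fin n → A, (∀ i, (x i, y i) ∈ V') →
        (FirstOrder.Language.Structure.funMap f x, FirstOrder.Language.Structure.funMap f y) ∈ V}
      univ_sets := ⟨univ, univ_mem, fun _ _ _ => mem_univ _⟩
      sets_of_superset := by
        rintro s t ⟨V', hV', h⟩ hst
        exact ⟨V', hV', fun x y hxy => hst (h x y hxy)⟩
      inter_sets := by
        rintro s t ⟨V', hV', h⟩ ⟨V'', hV'', h'⟩
        exact ⟨V' ∩ V'', inter_mem hV' hV'',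
          fun x y hxy => ⟨h x y fun i => (hxy i).1, h' x y fun i => (hxy i).2⟩⟩ }
  have hG : G ≤ 𝓤[sInf (unif '' S)] := by
    rw [sInf_eq_iInf', iInf_uniformity]
    refine le_iInf ?_
    rintro ⟨_, U, hU, rfl⟩ V hV
    obtain ⟨V', hV', h⟩ := U.compat f V hV
    have hle : sInf (unif '' S) ≤ U.unif := sInf_le ⟨U, hU, rfl⟩
    exact ⟨V', hle hV', h⟩
  intro V hV
  exact hG hV

instance : InfSet (CompUnif L A) where
  sInf S := ⟨sInf (unif '' S), isCompatible_sInf S⟩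

theorem isGLB_sInf (S : Set (CompUnif L A)) : IsGLB S (sInf S) :=
  ⟨fun U hU => show sInf (unif '' S) ≤ U.unif from sInf_le ⟨U, hU, rfl⟩,
    fun U hU => show U.unif ≤ sInf (unif '' S) from
      le_sInf (by rintro _ ⟨V, hV, rfl⟩; exact hU hV)⟩

/-- The lattice `Unif A` of compatible uniformities on `A`. -/
instance : CompleteLattice (CompUnif L A) := completeLatticeOfInf _ isGLB_sInf

/-- The uniformity `Ug {α}` of all relations that contain the congruence `α`. -/
def ofCongruence (α : Congruence L A) : CompUnif L A where
  unif := .ofCore <| .mk' (𝓟 α.graph)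
    (fun _ hr x => hr (show α.r x x from α.refl x))
    (fun _ hr => fun _ hp => hr (α.symm hp))
    (fun _ hr => ⟨α.graph, mem_principal_self _, by
      rintro ⟨x, z⟩ ⟨y, hxy, hyz⟩
      exact hr (show α.r x z from α.trans hxy hyz)⟩)
  compat := fun f _ hV => ⟨α.graph, mem_principal_self _, fun x y h => hV (α.compat f x y h)⟩

/-- The inverse image of a compatible uniformity under a homomorphism `f`: it has the relations
`f⁻¹(V)`, for `V` an entourage, as a base. -/
def comap {B : Type*} [L.Structure B] (f : B →[L] A) (U : CompUnif L A) : CompUnif L B where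
  unif := UniformSpace.comap f U.unif
  compat := by
    rintro n g V ⟨W, hW, hWV⟩
    obtain ⟨W', hW', h⟩ := U.compat g W hW
    refine ⟨_, preimage_mem_comap hW', fun x y hxy => hWV ?_⟩
    change (f _, f _) ∈ W
    rw [f.map_fun, f.map_fun]
    exact h _ _ hxy

/-- The compatible extension `f_{*c}(U)` of `U` along a homomorphism `f : A → B`: the meet of all
compatible uniformities `V` on `B` such that `U ≤ f⁻¹(V)`. -/
def pushforward {B : Type*} [L.Structure B] (f : A →[L] B) (U : CompUnif L A) : CompUnif L B :=
  sInf {V | U ≤ comap f V}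

/-- A compatible uniformity above the kernel of a surjective homomorphism is the inverse image of
exactly one compatible uniformity. -/
theorem existsUnique_comap_eq {B : Type*} [L.Structure B] (f : B →[L] A)
    (hf : Function.Surjective f) (T : CompUnif L B)
    (hT : ofCongruence (Congruence.ker f) ≤ T) : ∃! W : CompUnif L A, comap f W = T := by
  have hker : ∀ V ∈ 𝓤[T.unif], ∀ p q : B, f p = f q → (p, q) ∈ V := fun V hV p q h => hT hV h
  have h3 : ∀ V ∈ 𝓤[T.unif], ∃ V' ∈ 𝓤[T.unif], ∀ p q r s t o : B,
      f p = f q → (q, r) ∈ V' → f r = f s → (s, t) ∈ V' → f t = f o → (p, o) ∈ V := by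
    intro V hV
    obtain ⟨V₁, hV₁, h₁⟩ := @comp_mem_uniformity_sets _ T.unif _ hV
    obtain ⟨V₂, hV₂, h₂⟩ := @comp_mem_uniformity_sets _ T.unif _ hV₁
    obtain ⟨V₃, hV₃, h₃⟩ := @comp_mem_uniformity_sets _ T.unif _ hV₂
    have hsub : ∀ x y, (x, y) ∈ V₃ → (x, y) ∈ V₂ := fun x y h =>
      h₃ ⟨y, h, hker _ hV₃ y y rfl⟩
    refine ⟨V₃, hV₃, fun p q r s t o hpq hqr hrs hst hto => h₁ ⟨r, h₂ ⟨q, ?_, hsub _ _ hqr⟩, ?_⟩⟩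
    · exact hker _ hV₂ _ _ hpq
    · exact h₂ ⟨s, hker _ hV₂ _ _ hrs, h₃ ⟨t, hst, hker _ hV₃ _ _ hto⟩⟩
  let F : B × B → A × A := Prod.map f f
  have himg : ∀ V ∈ 𝓤[T.unif], F '' V ∈ map F 𝓤[T.unif] := fun V hV => image_mem_map hV
  refine ⟨⟨.ofCore <| .mk' (map F 𝓤[T.unif]) ?_ ?_ ?_, ?_⟩, ?_, ?_⟩
  · intro r hr x
    obtain ⟨p, rfl⟩ := hf x
    exact hker _ hr p p rfl
  · intro r hr
    exact @symm_le_uniformity _ T.unif _ hr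
  · intro r hr
    obtain ⟨V', hV', h⟩ := h3 _ hr
    refine ⟨F '' V', himg _ hV', ?_⟩
    rintro ⟨x, z⟩ ⟨y, ⟨⟨p, q⟩, hpq, he⟩, ⟨⟨q', o⟩, hqo, he'⟩⟩
    obtain ⟨rfl, rfl⟩ := Prod.mk.inj he
    obtain ⟨hq, rfl⟩ := Prod.mk.inj he'
    exact h p p q q' o o rfl hpq hq.symm hqo rfl
  · intro n g V hV
    obtain ⟨V', hV', h⟩ := T.compat g _ hV
    refine ⟨F '' V', himg _ hV', fun x y hxy => ?_⟩
    choose P hP hPe using hxy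
    have hx : x = f ∘ fun i => (P i).1 := funext fun i => (Prod.mk.inj (hPe i)).1.symm
    have hy : y = f ∘ fun i => (P i).2 := funext fun i => (Prod.mk.inj (hPe i)).2.symm
    have := h (fun i => (P i).1) (fun i => (P i).2) hP
    rw [hx, hy, ← f.map_fun, ← f.map_fun]
    exact this
  · refine ext_ent (le_antisymm ?_ le_comap_map)
    intro V hV
    obtain ⟨V', hV', h⟩ := h3 _ hV
    refine ⟨F '' V', himg _ hV', ?_⟩
    rintro ⟨p, o⟩ ⟨⟨q, r⟩, hqr, he⟩
    obtain ⟨h₁, h₂⟩ := Prod.mk.inj he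
    exact h p q r r r o h₁.symm hqr rfl (hker _ hV' r r rfl) h₂
  · intro W hW
    apply ext_ent
    change W.ent = map F 𝓤[T.unif]
    rw [← hW]
    exact (map_comap_of_surjective (hf.prodMap hf) W.ent).symm

end CompUnif

end Uniformities

section TermCondition

variable {L : FirstOrder.Language.{v, w}} {A : Type u} [L.Structure A]

/-- `Centralizes U V W` is the relation `C(U, V; W)`, that is, `W` satisfies the `U, V`-term
condition: for every `(n + n')`-ary term `t` and entourage `R` of `W` there are entourages
`P`, `Q`, `R'` of `U`, `V`, `W` such that for every matrix
`(t(a, b), t(a, c); t(a', b), t(a', c))` with `a P a'` and `b Q c` (componentwise), if the entries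
of the first row are related by `R'`, those of the second row are related by `R`. -/
def Centralizes (U V W : CompUnif L A) : Prop :=
  ∀ (n n' : ℕ) (t : L.Term (Fin n ⊕ Fin n')), ∀ R ∈ W.ent,
    ∃ P ∈ U.ent, ∃ Q ∈ V.ent, ∃ R' ∈ W.ent,
      ∀ (a a' : Fin n → A) (b c : Fin n' → A),
        (∀ i, (a i, a' i) ∈ P) → (∀ j, (b j, c j) ∈ Q) →
        (t.realize (Sum.elim a b), t.realize (Sum.elim a c)) ∈ R' →
        (t.realize (Sum.elim a' b), t.realize (Sum.elim a' c)) ∈ R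

/-- The commutator `[U, V]`: the least compatible uniformity `W` such that `C(U, V; W)`
(it is the least one by `isLeast_commutator`). -/
def commutator (U V : CompUnif L A) : CompUnif L A := sInf {W | Centralizes U V W}

theorem isLeast_commutator (U V : CompUnif L A) :
    IsLeast {W | Centralizes U V W} (commutator U V) := by
  refine ⟨?_, (CompUnif.isGLB_sInf _).1⟩
  intro n n' t
  let G : Filter (A × A) :=
    { sets := {R | ∃ P ∈ U.ent, ∃ Q ∈ V.ent, ∃ R' ∈ (commutator U V).ent,
        ∀ (a a' : Fin n → A) (b c : Fin n' → A),
          (∀ i, (a i, a' i) ∈ P) → (∀ j, (b j, c j) ∈ Q) →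
          (t.realize (Sum.elim a b), t.realize (Sum.elim a c)) ∈ R' →
          (t.realize (Sum.elim a' b), t.realize (Sum.elim a' c)) ∈ R}
      univ_sets := ⟨univ, univ_mem, univ, univ_mem, univ, univ_mem,
        fun _ _ _ _ _ _ _ => mem_univ _⟩
      sets_of_superset := by
        rintro s r ⟨P, hP, Q, hQ, R', hR', h⟩ hsr
        exact ⟨P, hP, Q, hQ, R', hR', fun a a' b c h₁ h₂ h₃ => hsr (h a a' b c h₁ h₂ h₃)⟩
      inter_sets := by
        rintro s r ⟨P, hP, Q, hQ, R', hR', h⟩ ⟨P₂, hP₂, Q₂, hQ₂, R₂, hR₂, h'⟩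
        exact ⟨P ∩ P₂, inter_mem hP hP₂, Q ∩ Q₂, inter_mem hQ hQ₂, R' ∩ R₂, inter_mem hR' hR₂,
          fun a a' b c h₁ h₂ h₃ =>
            ⟨h a a' b c (fun i => (h₁ i).1) (fun i => (h₂ i).1) h₃.1,
              h' a a' b c (fun i => (h₁ i).2) (fun i => (h₂ i).2) h₃.2⟩⟩ }
  have hG : G ≤ (commutator U V).ent := by
    change G ≤ 𝓤[sInf (CompUnif.unif '' {W | Centralizes U V W})]
    rw [sInf_eq_iInf', iInf_uniformity]
    refine le_iInf ?_
    rintro ⟨_, W, hW, rfl⟩ R hR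
    obtain ⟨P, hP, Q, hQ, R', hR', h⟩ := hW n n' t R hR
    have hle : commutator U V ≤ W := (CompUnif.isGLB_sInf _).1 hW
    exact ⟨P, hP, Q, hQ, R', hle hR', h⟩
  intro R hR
  exact hG hR

end TermCondition

section PairAlgebra

variable {L : FirstOrder.Language.{v, w}} {A : Type u} [L.Structure A]

/-- The underlying set of the algebra `A(α)` of pairs `(a, b)` with `a α b`. -/
def PairAlg (α : Congruence L A) : Type u := {p : A × A // α.r p.1 p.2}

/-- `A(α)` as a subalgebra of `A × A`. -/
instance (α : Congruence L A) : L.Structure (PairAlg α) where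
  funMap f x := ⟨(FirstOrder.Language.Structure.funMap f fun i => (x i).1.1,
    FirstOrder.Language.Structure.funMap f fun i => (x i).1.2), α.compat f _ _ fun i => (x i).2⟩
  RelMap r x := FirstOrder.Language.Structure.RelMap r (fun i => (x i).1.1) ∧
    FirstOrder.Language.Structure.RelMap r (fun i => (x i).1.2)

/-- The first projection `π : A(α) → A`. -/
def proj₁ (α : Congruence L A) : PairAlg α →[L] A where
  toFun p := p.1.1
  map_fun' _ _ := rfl
  map_rel' _ _ h := h.1

/-- The second projection `π' : A(α) → A`. -/
def proj₂ (α : Congruence L A) : PairAlg α →[L] A where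
  toFun p := p.1.2
  map_fun' _ _ := rfl
  map_rel' _ _ h := h.2

/-- The diagonal homomorphism `A → A(α)`, `a ↦ (a, a)`. -/
def diag (α : Congruence L A) : A →[L] PairAlg α where
  toFun a := ⟨(a, a), α.refl a⟩
  map_fun' _ _ := rfl
  map_rel' _ _ h := ⟨h, h⟩

/-- The uniformity `ker π` on `A(α)`. -/
def kerProj₁ (α : Congruence L A) : CompUnif L (PairAlg α) :=
  .ofCongruence (Congruence.ker (proj₁ α))

/-- The uniformity `ker π'` on `A(α)`. -/
def kerProj₂ (α : Congruence L A) : CompUnif L (PairAlg α) :=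
  .ofCongruence (Congruence.ker (proj₂ α))

/-- The compatible extension `Δ_{α,U}` of `U` along the diagonal homomorphism. -/
def Delta (α : Congruence L A) (U : CompUnif L A) : CompUnif L (PairAlg α) :=
  U.pushforward (diag α)

theorem existsUnique_commutator' (α : Congruence L A) (U : CompUnif L A) :
    ∃! W : CompUnif L A, W.comap (proj₂ α) = (Delta α U ⊓ kerProj₁ α) ⊔ kerProj₂ α :=
  CompUnif.existsUnique_comap_eq (proj₂ α) (fun a => ⟨⟨(a, a), α.refl a⟩, rfl⟩) _ le_sup_right

/-- `[α, U]'`: the unique compatible uniformity on `A` with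
`(π')⁻¹([α, U]') = (Δ_{α,U} ∧ ker π) ∨ ker π'`. -/
noncomputable def commutator' (α : Congruence L A) (U : CompUnif L A) : CompUnif L A :=
  (existsUnique_commutator' α U).choose

theorem comap_commutator' (α : Congruence L A) (U : CompUnif L A) :
    (commutator' α U).comap (proj₂ α) = (Delta α U ⊓ kerProj₁ α) ⊔ kerProj₂ α :=
  (existsUnique_commutator' α U).choose_spec.1

end PairAlgebra

end UnifComm

/-!
Call a uniformity `V` *shifting* for the congruences `θ` and `ψ` when, in rectangles `a θ b`,
`c θ d`, `a ψ c`, `b ψ d`, closeness of `b` to `d` forces closeness of `a` to `c`, uniformly.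
In a congruence-modular variety this holds whenever `θ ∧ ψ ≤ V`. It suffices to apply the modular
law to congruences on the algebra of quaternary term operations, one of which is "asymptotically
equal along the filter of rectangles" (`shifts_of_congruenceModular`). With an underlying group
the Mal'cev term `x y⁻¹ z` gives it at once (`shifts_of_malcev`).

On `A(α)` the kernels of `π` and `π'` meet in equality, so `Δ = Δ_{α,U}` shifts for them.
This makes the image of `Δ ∧ ker π` under `π'` a uniformity (`imageUnif`), so that
`[α, U]'`-closeness of `p` and `r` means `Δ`-closeness of some `(e, p)` and `(e, r)`. Moving `e`
by shifting and exchanging the coordinates then yields the term condition for `[α, U]'`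
(`centralizes_commutator'`), which is `[α, U] ≤ [α, U]'`.

For the converse inequality, if `W` satisfies the term condition and `A` has an underlying group,
then closeness of `a` to `c` in `U` and of `a⁻¹b` to `c⁻¹d` in `W` defines a compatible uniformity
on `A(α)` (`quotientUnif`). It lies above `Δ`, and on pairs with equal first coordinates it is
`W`-closeness of the second ones, so `[α, U]' ≤ W` (`commutator'_le_of_centralizes`).
-/

namespace UnifComm

open Filter Set
open scoped Uniformity FirstOrder

/-! ### Compatible uniformities and the shifting property -/

section Basics

variable {L : FirstOrder.Language.{v, w}} {A : Type u} [L.Structure A]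

namespace CompUnif

theorem refl_mem_ent (U : CompUnif L A) {V : Set (A × A)} (hV : V ∈ U.ent) (x : A) :
    (x, x) ∈ V :=
  @refl_mem_uniformity _ U.unif x V hV

theorem ent_inf (U V : CompUnif L A) : (U ⊓ V).ent = U.ent ⊓ V.ent := by
  change 𝓤[sInf (unif '' {U, V})] = _
  rw [image_pair, sInf_pair]
  rfl

theorem le_of_comap_le_comap {B : Type*} [L.Structure B] {f : B →[L] A}
    (hf : Function.Surjective f) {U V : CompUnif L A} (h : comap f U ≤ comap f V) : U ≤ V := by
  change U.ent ≤ V.ent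
  have h' := Filter.map_mono (m := Prod.map f f) h
  rw [← Filter.map_comap_of_surjective (hf.prodMap hf) U.ent,
    ← Filter.map_comap_of_surjective (hf.prodMap hf) V.ent]
  exact h'

theorem ofCongruence_ker_le_comap {B : Type*} [L.Structure B] (f : B →[L] A)
    (U : CompUnif L A) : ofCongruence (Congruence.ker f) ≤ comap f U := by
  rintro R ⟨V, hV, hVR⟩ ⟨x, y⟩ hxy
  refine hVR ?_
  change (f x, f y) ∈ V
  rw [show f x = f y from hxy]
  exact U.refl_mem_ent hV _

theorem le_comap_pushforward {B : Type*} [L.Structure B] (f : A →[L] B) (U : CompUnif L A) :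
    U ≤ comap f (pushforward f U) := by
  change U.ent ≤ Filter.comap _ 𝓤[sInf (unif '' {V | U ≤ comap f V})]
  rw [sInf_eq_iInf', iInf_uniformity, comap_iInf]
  refine le_iInf ?_
  rintro ⟨_, V, hV, rfl⟩
  exact hV

theorem pushforward_le {B : Type*} [L.Structure B] {f : A →[L] B} {U : CompUnif L A}
    {V : CompUnif L B} (h : U ≤ comap f V) : pushforward f U ≤ V :=
  (isGLB_sInf _).1 h

theorem tendsto_refl (U : CompUnif L A) {X : Type*} {l : Filter X} (x : X → A) :
    Tendsto (fun z => (x z, x z)) l U.ent := fun _ hR =>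
  mem_map.2 (mem_of_superset univ_mem fun z _ => U.refl_mem_ent hR (x z))

theorem tendsto_symm {U : CompUnif L A} {X : Type*} {l : Filter X} {x y : X → A}
    (h : Tendsto (fun z => (x z, y z)) l U.ent) : Tendsto (fun z => (y z, x z)) l U.ent :=
  @Tendsto.uniformity_symm _ _ U.unif _ _ h

theorem tendsto_trans {U : CompUnif L A} {X : Type*} {l : Filter X} {x y z : X → A}
    (h : Tendsto (fun i => (x i, y i)) l U.ent) (h' : Tendsto (fun i => (y i, z i)) l U.ent) :
    Tendsto (fun i => (x i, z i)) l U.ent :=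
  @Tendsto.uniformity_trans _ _ U.unif _ _ _ _ h h'

/-- Term operations are uniformly continuous for every compatible uniformity. -/
theorem exists_forall_realize_mem (U : CompUnif L A) {ι : Type*} (t : L.Term ι) :
    ∀ R ∈ U.ent, ∃ R' ∈ U.ent, ∀ x y : ι → A, (∀ i, (x i, y i) ∈ R') →
      (t.realize x, t.realize y) ∈ R := by
  induction t with
  | var i => exact fun R hR => ⟨R, hR, fun x y h => h i⟩
  | func f ts ih =>
    intro R hR
    obtain ⟨V, hV, h⟩ := U.compat f R hR
    choose T hT hTV using fun i => ih i V hV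
    refine ⟨⋂ i, T i, iInter_mem.2 hT, fun x y hxy => h _ _ fun i => ?_⟩
    exact hTV i x y fun j => mem_iInter.1 (hxy j) i

theorem tendsto_realize (U : CompUnif L A) {ι X : Type*} [Finite ι] (t : L.Term ι)
    {l : Filter X} {x y : X → ι → A}
    (h : ∀ i, Tendsto (fun z => (x z i, y z i)) l U.ent) :
    Tendsto (fun z => (t.realize (x z), t.realize (y z))) l U.ent := by
  intro R hR
  obtain ⟨R', hR', ht⟩ := U.exists_forall_realize_mem t R hR
  exact mem_map.2 <| mem_of_superset (iInter_mem.2 fun i => mem_map.1 (h i hR'))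
    fun z hz => ht _ _ fun i => mem_iInter.1 hz i

end CompUnif

theorem Congruence.realize_rel (α : Congruence L A) {ι : Type*} (t : L.Term ι) {x y : ι → A}
    (h : ∀ i, α.r (x i) (y i)) : α.r (t.realize x) (t.realize y) := by
  induction t with
  | var i => exact h i
  | func f ts ih => exact α.compat f _ _ ih

/-- `V` shifts rectangles whose sides lie in the congruences `θ` and `ψ`: if `a θ b`, `c θ d`,
`a ψ c` and `b ψ d`, then `a` is as `V`-close to `c` as wanted once `b` is `V`-close enough
to `d`, uniformly in the rectangle. -/
def Shifts (θ ψ : Congruence L A) (V : CompUnif L A) : Prop :=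
  ∀ R ∈ V.ent, ∃ S ∈ V.ent, ∀ a b c d : A, θ.r a b → θ.r c d → ψ.r a c → ψ.r b d →
    (b, d) ∈ S → (a, c) ∈ R

end Basics

/-! ### The shifting lemma for uniformities in congruence-modular varieties -/

section Shifting

variable (L : FirstOrder.Language.{v, w}) (B : Type u) [L.Structure B]

/-- The quaternary term operations of `B`. This is the free algebra on four generators of the
variety generated by `B`; as a set of functions it lives in the universe of `B`, whatever the
universes of the language. -/
def QuaternaryOp : Type u := {f : (Fin 4 → B) → B // ∃ t : L.Term (Fin 4), ∀ v, f v = t.realize v}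

variable {L B}

namespace QuaternaryOp

/-- The operations are pointwise. Relation symbols, which play no role for algebras, are interpreted
as always true. -/
instance : L.Structure (QuaternaryOp L B) where
  funMap f x := ⟨fun v => FirstOrder.Language.Structure.funMap f fun i => (x i).1 v, by
    choose t ht using fun i => (x i).2
    exact ⟨.func f t, fun v => congrArg _ (funext fun i => ht i v)⟩⟩
  RelMap _ _ := True

theorem realize_apply {ι : Type*} (t : L.Term ι) (x : ι → QuaternaryOp L B) (v : Fin 4 → B) :
    (t.realize x).1 v = t.realize fun i => (x i).1 v := by
  induction t with
  | var i => rfl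
  | func f ts ih => exact congrArg _ (funext ih)

theorem satisfies {E : Set (L.Term ℕ × L.Term ℕ)} (h : Satisfies E B) :
    Satisfies E (QuaternaryOp L B) := fun e he x =>
  Subtype.ext <| funext fun v => by
    rw [realize_apply, realize_apply]
    exact h e he _

/-- The `i`-th projection. -/
def coord (i : Fin 4) : QuaternaryOp L B := ⟨fun v => v i, .var i, fun _ => rfl⟩

/-- The congruence of agreeing on a given set of quadruples. -/
def agreeOn (S : Set (Fin 4 → B)) : Congruence L (QuaternaryOp L B) where
  r f g := ∀ v ∈ S, f.1 v = g.1 v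
  iseqv := ⟨fun _ _ _ => rfl, fun h v hv => (h v hv).symm,
    fun h h' v hv => (h v hv).trans (h' v hv)⟩
  compat := fun f _ _ h v hv => congrArg (FirstOrder.Language.Structure.funMap f)
    (funext fun i => h i v hv)

/-- The congruence of being asymptotically equal with respect to `V` along a filter of
quadruples. -/
def asymptotic (V : CompUnif L B) (l : Filter (Fin 4 → B)) :
    Congruence L (QuaternaryOp L B) where
  r f g := Tendsto (fun v => (f.1 v, g.1 v)) l V.ent
  iseqv := ⟨fun f => V.tendsto_refl f.1, CompUnif.tendsto_symm, CompUnif.tendsto_trans⟩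
  compat := by
    intro n f x y h R hR
    obtain ⟨R', hR', hf⟩ := V.compat f R hR
    exact mem_map.2 <| mem_of_superset (iInter_mem.2 fun i => mem_map.1 (h i hR'))
      fun v hv => hf _ _ fun i => mem_iInter.1 hv i

end QuaternaryOp

open QuaternaryOp in
/-- The shifting lemma. On quadruples `(a, b, d, c)` that run through the rectangles, the operations
agreeing on `(x, y, y, z)` become asymptotically equal as `b` and `d` get close, and those agreeing
both on `(x, x, y, y)` and on `(x, y, y, x)` differ by an element of `θ ∧ ψ`. The modular law
therefore makes the first and the last projection, that is `a` and `c`, asymptotically equal. -/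
theorem shifts_of_congruenceModular {E : Set (L.Term ℕ × L.Term ℕ)} (hB : Satisfies E B)
    (hE : CongruenceModular.{u} E) {θ ψ : Congruence L B} {V : CompUnif L B}
    (hV : ∀ x y, θ.r x y → ψ.r x y → ∀ R ∈ V.ent, (x, y) ∈ R) : Shifts θ ψ V := by
  have := hE (QuaternaryOp L B) (satisfies hB)
  let D : Set (Fin 4 → B) := {v | θ.r (v 0) (v 1) ∧ θ.r (v 3) (v 2) ∧ ψ.r (v 0) (v 3) ∧
    ψ.r (v 1) (v 2)}
  let l : Filter (Fin 4 → B) := 𝓟 D ⊓ comap (fun v => (v 1, v 2)) V.ent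
  let α : Congruence L (QuaternaryOp L B) := agreeOn {v | v 0 = v 3 ∧ v 1 = v 2}
  let β : Congruence L (QuaternaryOp L B) := agreeOn {v | v 0 = v 1 ∧ v 2 = v 3}
  let γ : Congruence L (QuaternaryOp L B) := agreeOn {v | v 1 = v 2}
  have hγα : γ ≤ α := fun f g h v hv => h v hv.2
  have hγδ : γ ≤ asymptotic V l := by
    -- every operation is asymptotically unchanged when the third argument is replaced by the second
    have key : ∀ f : QuaternaryOp L B,
        Tendsto (fun v => (f.1 v, f.1 ![v 0, v 1, v 1, v 3])) l V.ent := by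
      rintro ⟨f, t, ht⟩
      simp only [ht]
      refine V.tendsto_realize t fun i => ?_
      fin_cases i
      · exact V.tendsto_refl _
      · exact V.tendsto_refl _
      · exact CompUnif.tendsto_symm (tendsto_comap.mono_left inf_le_right :
          Tendsto (fun v : Fin 4 → B => (v 1, v 2)) l V.ent)
      · exact V.tendsto_refl _
    intro f g h
    refine CompUnif.tendsto_trans (key f) (CompUnif.tendsto_symm ?_)
    have hfg : ∀ v : Fin 4 → B, f.1 ![v 0, v 1, v 1, v 3] = g.1 ![v 0, v 1, v 1, v 3] :=
      fun v => h _ rfl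
    simp only [hfg]
    exact key g
  have hαβδ : β ⊓ α ≤ asymptotic V l := by
    intro f g h R hR
    have hβ : β.r f g := (inf_le_left : β ⊓ α ≤ β) h
    have hα : α.r f g := (inf_le_right : β ⊓ α ≤ α) h
    refine mem_map.2 (mem_of_superset (mem_inf_of_left (mem_principal_self D)) ?_)
    rintro v ⟨h₁, h₂, h₃, h₄⟩
    have hθ : ∀ k : QuaternaryOp L B, θ.r (k.1 v) (k.1 ![v 0, v 0, v 3, v 3]) := by
      rintro ⟨k, t, ht⟩
      simp only [ht]
      refine θ.realize_rel t fun i => ?_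
      fin_cases i
      exacts [θ.refl _, θ.symm h₁, θ.symm h₂, θ.refl _]
    have hψ : ∀ k : QuaternaryOp L B, ψ.r (k.1 v) (k.1 ![v 0, v 1, v 1, v 0]) := by
      rintro ⟨k, t, ht⟩
      simp only [ht]
      refine ψ.realize_rel t fun i => ?_
      fin_cases i
      exacts [ψ.refl _, ψ.refl _, ψ.symm h₄, ψ.symm h₃]
    refine hV _ _ (θ.trans (hθ f) ?_) (ψ.trans (hψ f) ?_) R hR
    · rw [hβ ![v 0, v 0, v 3, v 3] ⟨rfl, rfl⟩]
      exact θ.symm (hθ g)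
    · rw [hα ![v 0, v 1, v 1, v 0] ⟨rfl, rfl⟩]
      exact ψ.symm (hψ g)
  have hmem : ((γ ⊔ β) ⊓ α).r (coord 0) (coord 3) := by
    rintro _ ⟨_, rfl | rfl, rfl⟩
    · have h₁ : (γ ⊔ β).r (coord 0) (coord 1) :=
        (le_sup_right : β ≤ γ ⊔ β) (fun v hv => hv.1)
      have h₂ : (γ ⊔ β).r (coord 1) (coord 2) :=
        (le_sup_left : γ ≤ γ ⊔ β) (fun v hv => hv)
      have h₃ : (γ ⊔ β).r (coord 2) (coord 3) :=
        (le_sup_right : β ≤ γ ⊔ β) (fun v hv => hv.2)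
      exact (γ ⊔ β).trans h₁ ((γ ⊔ β).trans h₂ h₃)
    · exact fun v hv => hv.1
  have hlim : (asymptotic V l).r (coord 0) (coord 3) :=
    ((sup_inf_le_assoc_of_le β hγα).trans (sup_le hγδ hαβδ)) hmem
  intro R hR
  obtain ⟨D', hD', T, ⟨S, hS, hST⟩, hDT⟩ := mem_inf_iff.1 (mem_map.1 (hlim hR))
  refine ⟨S, hS, fun a b c d h₁ h₂ h₃ h₄ hbd => ?_⟩
  have hv : ![a, b, d, c] ∈ D' ∩ T := ⟨hD' ⟨h₁, h₂, h₃, h₄⟩, hST hbd⟩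
  rw [← hDT] at hv
  exact hv

end Shifting

/-! ### The inequality `[α, U] ≤ [α, U]'` -/

section Centralizing

variable {L : FirstOrder.Language.{v, w}} {A : Type u} [L.Structure A]

theorem realize_fst {α : Congruence L A} {ι : Type*} (t : L.Term ι) (x : ι → PairAlg α) :
    (t.realize x).1.1 = t.realize fun i => (x i).1.1 :=
  (FirstOrder.Language.HomClass.realize_term (proj₁ α)).symm

theorem realize_snd {α : Congruence L A} {ι : Type*} (t : L.Term ι) (x : ι → PairAlg α) :
    (t.realize x).1.2 = t.realize fun i => (x i).1.2 :=
  (FirstOrder.Language.HomClass.realize_term (proj₂ α)).symm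

theorem satisfies_pairAlg {E : Set (L.Term ℕ × L.Term ℕ)} (h : Satisfies E A)
    (α : Congruence L A) : Satisfies E (PairAlg α) := fun e he x =>
  Subtype.ext <| Prod.ext (by rw [realize_fst, realize_fst]; exact h e he _)
    (by rw [realize_snd, realize_snd]; exact h e he _)

theorem proj₂_surjective (α : Congruence L A) : Function.Surjective (proj₂ α) :=
  fun a => ⟨⟨(a, a), α.refl a⟩, rfl⟩

/-- The automorphism `(a, b) ↦ (b, a)` of `A(α)`. -/
def swapHom (α : Congruence L A) : PairAlg α →[L] PairAlg α where
  toFun p := ⟨(p.1.2, p.1.1), α.symm p.2⟩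
  map_fun' _ _ := rfl
  map_rel' _ _ h := ⟨h.2, h.1⟩

theorem Delta_le_comap_swapHom (α : Congruence L A) (U : CompUnif L A) :
    Delta α U ≤ (Delta α U).comap (swapHom α) := by
  refine CompUnif.pushforward_le ?_
  intro R hR
  obtain ⟨V, ⟨V', hV', hVV'⟩, hVR⟩ := hR
  exact CompUnif.le_comap_pushforward (diag α) U ⟨V', hV', fun p hp => hVR (hVV' hp)⟩

theorem mem_ent_Delta_inf_kerProj₁ {α : Congruence L A} {U : CompUnif L A}
    {R : Set (PairAlg α × PairAlg α)} :
    R ∈ (Delta α U ⊓ kerProj₁ α).ent ↔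
      ∃ V ∈ (Delta α U).ent, ∀ x y, (x, y) ∈ V → x.1.1 = y.1.1 → (x, y) ∈ R := by
  rw [CompUnif.ent_inf]
  constructor
  · intro h
    obtain ⟨V, hV, K, hK, rfl⟩ := mem_inf_iff.1 h
    exact ⟨V, hV, fun x y hxy he => ⟨hxy, hK he⟩⟩
  · rintro ⟨V, hV, h⟩
    refine mem_inf_iff_superset.2 ⟨V, hV, _, mem_principal_self _, ?_⟩
    rintro ⟨x, y⟩ ⟨hxy, he⟩
    exact h x y hxy he

/-- The image of `Δ ∧ ker π` under `π'`. In general it is only a filter of reflexive symmetric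
relations; the shifting property makes two of its entourages composable, by moving their
first coordinates together. -/
def imageUnif (α : Congruence L A) (U : CompUnif L A)
    (h : Shifts (Congruence.ker (proj₂ α)) (Congruence.ker (proj₁ α)) (Delta α U)) :
    CompUnif L A where
  unif := .ofCore <| .mk' (map (Prod.map (proj₂ α) (proj₂ α)) (Delta α U ⊓ kerProj₁ α).ent)
    (fun _ hr x => (Delta α U ⊓ kerProj₁ α).refl_mem_ent hr ⟨(x, x), α.refl x⟩)
    (fun _ hr => @symm_le_uniformity _ (Delta α U ⊓ kerProj₁ α).unif _ hr)
    (by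
      intro r hr
      obtain ⟨V, hV, hVr⟩ := mem_ent_Delta_inf_kerProj₁.1 (mem_map.1 hr)
      obtain ⟨V₁, hV₁, hV₁V⟩ := @comp_mem_uniformity_sets _ (Delta α U).unif _ hV
      obtain ⟨S, hS, hSV⟩ := h V₁ hV₁
      refine ⟨_, image_mem_map (mem_ent_Delta_inf_kerProj₁ (R := S ∩ V₁ ∩ {p | p.1.1.1 = p.2.1.1}).2
        ⟨S ∩ V₁, inter_mem hS hV₁, fun x y hxy he => ⟨hxy, he⟩⟩), ?_⟩
      rintro ⟨x, z⟩ ⟨y, ⟨⟨p, q⟩, ⟨hpq, e₁⟩, he⟩, ⟨⟨p', q'⟩, ⟨hpq', e₂⟩, he'⟩⟩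
      obtain ⟨rfl, hq⟩ := Prod.mk.inj he
      obtain ⟨hp', rfl⟩ := Prod.mk.inj he'
      have hq' : q.1.2 = p'.1.2 := hq.trans hp'.symm
      have e₂' : p'.1.1 = q'.1.1 := e₂
      -- `p = (e, x)` and `q = (e, y)` are close, `p' = (e', y)` and `q' = (e', z)` are close;
      -- shifting `e'` to `e` makes `(e, y)` and `(e, z)` close
      have hα : α.r q.1.1 q'.1.2 := by
        refine α.trans q.2 ?_
        rw [hq']
        refine α.trans (α.symm p'.2) ?_
        rw [e₂']
        exact q'.2
      exact hVr p ⟨(q.1.1, q'.1.2), hα⟩ (hV₁V ⟨q, hpq.2, hSV _ p' _ q' hq' rfl rfl e₂ hpq'.1⟩) e₁)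
  compat := by
    intro n f R hR
    obtain ⟨V, hV, hVR⟩ := (Delta α U ⊓ kerProj₁ α).compat f _ hR
    refine ⟨_, image_mem_map hV, fun x y hxy => ?_⟩
    choose P hP hPe using hxy
    have hx : x = proj₂ α ∘ fun i => (P i).1 :=
      funext fun i => (Prod.mk.inj (hPe i)).1.symm
    have hy : y = proj₂ α ∘ fun i => (P i).2 :=
      funext fun i => (Prod.mk.inj (hPe i)).2.symm
    rw [hx, hy, ← (proj₂ α).map_fun, ← (proj₂ α).map_fun]
    exact hVR _ _ hP

theorem commutator'_le_imageUnif {α : Congruence L A} {U : CompUnif L A}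
    (h : Shifts (Congruence.ker (proj₂ α)) (Congruence.ker (proj₁ α)) (Delta α U)) :
    commutator' α U ≤ imageUnif α U h := by
  refine CompUnif.le_of_comap_le_comap (proj₂_surjective α) ?_
  rw [comap_commutator']
  exact sup_le le_comap_map (CompUnif.ofCongruence_ker_le_comap _ _)

theorem exists_Delta_of_mem_commutator' {α : Congruence L A} {U : CompUnif L A}
    {R : Set (A × A)} (hR : R ∈ (commutator' α U).ent) :
    ∃ V ∈ (Delta α U).ent, ∀ x y, (x, y) ∈ V → x.1.1 = y.1.1 → (x.1.2, y.1.2) ∈ R := by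
  have hle : Delta α U ⊓ kerProj₁ α ≤ (commutator' α U).comap (proj₂ α) := by
    rw [comap_commutator']
    exact le_sup_left
  exact mem_ent_Delta_inf_kerProj₁.1 (hle (preimage_mem_comap hR))

/-- For a matrix `(p, r; q, s)` of the term condition, the pairs `(p, q)` and `(r, s)` are
`Δ`-close. If `p` and `r` are `[α, U]'`-close, some `(e, p)` and `(e, r)` are `Δ`-close, and
shifting `e` to `q` and swapping coordinates makes `(p, q)` and `(r, q)` `Δ`-close. Hence so are
`(r, q)` and `(r, s)`, which makes `q` and `s` `[α, U]'`-close. -/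
theorem centralizes_commutator' {α : Congruence L A} {U : CompUnif L A}
    (h : Shifts (Congruence.ker (proj₂ α)) (Congruence.ker (proj₁ α)) (Delta α U)) :
    Centralizes (.ofCongruence α) U (commutator' α U) := by
  intro n n' t R hR
  obtain ⟨V, hV, hVR⟩ := exists_Delta_of_mem_commutator' hR
  obtain ⟨V₁, hV₁, hsymm, hcomp⟩ := @comp_symm_of_uniformity _ (Delta α U).unif _ hV
  obtain ⟨S, hS, hSV₁⟩ := h _ (Delta_le_comap_swapHom α U (preimage_mem_comap hV₁))
  obtain ⟨T, hT, hTV₁⟩ := (Delta α U).exists_forall_realize_mem t V₁ hV₁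
  have hR' := commutator'_le_imageUnif h (image_mem_map
    (mem_ent_Delta_inf_kerProj₁ (R := S ∩ {p | p.1.1.1 = p.2.1.1}).2
      ⟨S, hS, fun x y hxy he => ⟨hxy, he⟩⟩))
  refine ⟨α.graph, mem_principal_self _, _,
    CompUnif.le_comap_pushforward (diag α) U (preimage_mem_comap hT), _, hR', ?_⟩
  rintro a a' b c ha hbc ⟨⟨x, y⟩, ⟨hxy, e⟩, he⟩
  have hp : x.1.2 = t.realize (Sum.elim a b) := (Prod.mk.inj he).1
  have hr : y.1.2 = t.realize (Sum.elim a c) := (Prod.mk.inj he).2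
  let X : Fin n ⊕ Fin n' → PairAlg α := Sum.elim (fun i => ⟨(a i, a' i), ha i⟩) (diag α ∘ b)
  let Y : Fin n ⊕ Fin n' → PairAlg α := Sum.elim (fun i => ⟨(a i, a' i), ha i⟩) (diag α ∘ c)
  have hXY : (t.realize X, t.realize Y) ∈ V₁ := by
    refine hTV₁ X Y ?_
    rintro (i | j)
    · exact (Delta α U).refl_mem_ent hT _
    · exact hbc j
  have hX₁ : (t.realize X).1.1 = t.realize (Sum.elim a b) := by
    rw [realize_fst]
    exact congrArg t.realize (funext fun i => by cases i <;> rfl)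
  have hX₂ : (t.realize X).1.2 = t.realize (Sum.elim a' b) := by
    rw [realize_snd]
    exact congrArg t.realize (funext fun i => by cases i <;> rfl)
  have hY₁ : (t.realize Y).1.1 = t.realize (Sum.elim a c) := by
    rw [realize_fst]
    exact congrArg t.realize (funext fun i => by cases i <;> rfl)
  have hY₂ : (t.realize Y).1.2 = t.realize (Sum.elim a' c) := by
    rw [realize_snd]
    exact congrArg t.realize (funext fun i => by cases i <;> rfl)
  rw [← hX₂, ← hY₂]
  generalize t.realize X = P at *
  generalize t.realize Y = Q at *
  have hxP : x.1.2 = P.1.1 := hp.trans hX₁.symm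
  have hyQ : y.1.2 = Q.1.1 := hr.trans hY₁.symm
  have e' : x.1.1 = y.1.1 := e
  have hα : α.r Q.1.1 P.1.2 := by
    rw [← hyQ]
    refine α.trans (α.symm y.2) ?_
    rw [← e']
    refine α.trans x.2 ?_
    rw [hxP]
    exact P.2
  have hshift := hSV₁ ⟨(P.1.2, P.1.1), α.symm P.2⟩ x ⟨(P.1.2, Q.1.1), α.symm hα⟩ y
    hxP.symm hyQ.symm rfl e hxy
  exact hVR ⟨(Q.1.1, P.1.2), hα⟩ Q (hcomp ⟨P, hsymm hshift, hXY⟩) rfl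

end Centralizing

/-! ### Algebras with an underlying group -/

section Groups

variable {L : FirstOrder.Language.{v, w}} {A : Type u} [L.Structure A]

theorem shifts_of_malcev (t : L.Term (Fin 3)) (h₁ : ∀ v : Fin 3 → A, v 1 = v 2 → t.realize v = v 0)
    (h₂ : ∀ v : Fin 3 → A, v 0 = v 1 → t.realize v = v 2) {θ ψ : Congruence L A} {V : CompUnif L A}
    (hV : ∀ x y, θ.r x y → ψ.r x y → ∀ R ∈ V.ent, (x, y) ∈ R) : Shifts θ ψ V := by
  intro R hR
  obtain ⟨R₁, hR₁, hcomp⟩ := @comp_mem_uniformity_sets _ V.unif _ hR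
  obtain ⟨S, hS, ht⟩ := V.exists_forall_realize_mem t R₁ hR₁
  refine ⟨S, hS, fun a b c d hab hcd hac hbd hmem => hcomp ⟨t.realize ![a, b, d], ?_, ?_⟩⟩
  · have := ht ![a, b, b] ![a, b, d] fun i => by
      fin_cases i
      exacts [V.refl_mem_ent hS _, V.refl_mem_ent hS _, hmem]
    rwa [h₁ _ rfl] at this
  · refine hV _ _ ?_ ?_ _ hR₁
    · have : θ.r (t.realize ![a, b, d]) (t.realize ![b, b, d]) := θ.realize_rel t fun i => by
        fin_cases i
        exacts [hab, θ.refl _, θ.refl _]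
      rw [h₂ ![b, b, d] rfl] at this
      exact θ.trans this (θ.symm hcd)
    · have : ψ.r (t.realize ![a, b, d]) (t.realize ![c, d, d]) := ψ.realize_rel t fun i => by
        fin_cases i
        exacts [hac, hbd, ψ.refl _]
      rwa [h₁ ![c, d, d] rfl] at this

theorem exists_malcev (h : HasUnderlyingGroup L A) : ∃ t : L.Term (Fin 3),
    (∀ v : Fin 3 → A, v 1 = v 2 → t.realize v = v 0) ∧
      ∀ v : Fin 3 → A, v 0 = v 1 → t.realize v = v 2 := by
  obtain ⟨_, ⟨m, hm⟩, ⟨i, hi⟩⟩ := h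
  have key : ∀ v : Fin 3 → A,
      (m.subst ![m.subst ![.var 0, i.subst ![.var 1] ], .var 2]).realize v =
        v 0 * (v 1)⁻¹ * v 2 := by
    intro v
    rw [FirstOrder.Language.Term.realize_subst, ← hm, ← hm, ← hi]
    congr 1
    funext j
    fin_cases j
    · change (m.subst _).realize _ = m.realize _
      rw [FirstOrder.Language.Term.realize_subst]
      congr 1
      funext j
      fin_cases j
      · rfl
      · change (i.subst _).realize _ = i.realize _
        rw [FirstOrder.Language.Term.realize_subst]
        congr 1
        funext j
        fin_cases j
        rfl
    · rfl
  exact ⟨_, fun v hv => by rw [key, hv, inv_mul_cancel_right],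
    fun v hv => by rw [key, hv, mul_inv_cancel, one_mul]⟩

/-- For a basic operation `f`, the operation `(e, a) ↦ f(a)⁻¹ f(ae)` is a term operation. -/
theorem exists_deviation_term [Group A] {m : L.Term (Fin 2)}
    (hm : ∀ x y : A, m.realize ![x, y] = x * y) {i : L.Term (Fin 1)}
    (hi : ∀ x : A, i.realize ![x] = x⁻¹) {n : ℕ} (f : L.Functions n) :
    ∃ t : L.Term (Fin n ⊕ Fin n), ∀ e a : Fin n → A, t.realize (Sum.elim e a) =
      (FirstOrder.Language.Structure.funMap f a)⁻¹ *
        FirstOrder.Language.Structure.funMap f (a * e) := by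
  refine ⟨m.subst ![i.subst ![.func f fun k => .var (.inr k)],
    .func f fun k => m.subst ![.var (.inr k), .var (.inl k)] ], fun e a => ?_⟩
  rw [FirstOrder.Language.Term.realize_subst, ← hm, ← hi]
  congr 1
  funext j
  fin_cases j
  · change (i.subst _).realize _ = i.realize _
    rw [FirstOrder.Language.Term.realize_subst]
    congr 1
    funext j
    fin_cases j
    rfl
  · change FirstOrder.Language.Structure.funMap f _ = FirstOrder.Language.Structure.funMap f _
    congr 1
    funext k
    rw [FirstOrder.Language.Term.realize_subst]
    change _ = a k * e k
    rw [← hm]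
    congr 1
    funext j
    fin_cases j <;> rfl

/-- The uniformity on `A(α)` for which `(a, b)` and `(c, d)` are close when `a` and `c` are
`U`-close and `a⁻¹b` and `c⁻¹d` are `W`-close. Its compatibility is the term condition
`C(α, U; W)` for the terms `f(a)⁻¹ f(ae)`: these are `1` for `e = 1`, hence vary little with `a`
for every `e` congruent to `1`. -/
def quotientUnif [Group A] {m : L.Term (Fin 2)} (hm : ∀ x y : A, m.realize ![x, y] = x * y)
    {i : L.Term (Fin 1)} (hi : ∀ x : A, i.realize ![x] = x⁻¹) {α : Congruence L A}
    {U W : CompUnif L A} (hC : Centralizes (.ofCongruence α) U W) : CompUnif L (PairAlg α) where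
  unif := U.unif.comap (proj₁ α) ⊓ W.unif.comap fun p : PairAlg α => p.1.1⁻¹ * p.1.2
  compat := by
    intro n f R hR
    rw [inf_uniformity] at hR
    obtain ⟨_, ⟨P₀, hP₀, hP₀'⟩, _, ⟨R₀, hR₀, hR₀'⟩, hPR⟩ := mem_inf_iff_superset.1 hR
    obtain ⟨P₁, hP₁, hf⟩ := U.compat f P₀ hP₀
    obtain ⟨R₁, hR₁, hcomp⟩ := @comp_mem_uniformity_sets _ W.unif _ hR₀
    obtain ⟨t, ht⟩ := exists_deviation_term hm hi f
    obtain ⟨P, hP, Q, hQ, R', hR', htC⟩ := hC n n t R₁ hR₁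
    obtain ⟨R₂, hR₂, htR⟩ := W.exists_forall_realize_mem t R₁ hR₁
    refine ⟨_, inter_mem_inf (preimage_mem_comap (inter_mem hP₁ hQ)) (preimage_mem_comap hR₂),
      fun x y hxy => hPR ⟨hP₀' (hf _ _ fun k => (hxy k).1.1), hR₀' ?_⟩⟩
    let a : Fin n → A := fun k => (x k).1.1
    let c : Fin n → A := fun k => (y k).1.1
    let e : Fin n → A := fun k => (x k).1.1⁻¹ * (x k).1.2
    let h : Fin n → A := fun k => (y k).1.1⁻¹ * (y k).1.2
    have hone : ∀ a : Fin n → A, t.realize (Sum.elim 1 a) = 1 := fun a => by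
      rw [ht, mul_one, inv_mul_cancel]
    have h₁ : (t.realize (Sum.elim e a), t.realize (Sum.elim h a)) ∈ R₁ := by
      refine htR _ _ ?_
      rintro (k | k)
      · exact (hxy k).2
      · exact W.refl_mem_ent hR₂ _
    have h₂ : (t.realize (Sum.elim h a), t.realize (Sum.elim h c)) ∈ R₁ := by
      refine htC 1 h a c (fun k => hP ?_) (fun k => (hxy k).1.2) ?_
      · have := α.realize_rel m (x := ![(y k).1.1⁻¹, (y k).1.1]) (y := ![(y k).1.1⁻¹, (y k).1.2])
          fun j => by
            fin_cases j
            exacts [α.refl _, (y k).2]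
        rw [hm, hm, inv_mul_cancel] at this
        exact this
      · rw [hone, hone]
        exact W.refl_mem_ent hR' _
    have hdiv : ∀ z : Fin n → PairAlg α, t.realize (Sum.elim
        (fun k => (z k).1.1⁻¹ * (z k).1.2) fun k => (z k).1.1) =
        (FirstOrder.Language.Structure.funMap f z).1.1⁻¹ *
          (FirstOrder.Language.Structure.funMap f z).1.2 := by
      intro z
      rw [ht]
      congr 2
      funext k
      exact mul_inv_cancel_left _ _
    have h₃ : (t.realize (Sum.elim e a), t.realize (Sum.elim h c)) ∈ R₀ := hcomp ⟨_, h₁, h₂⟩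
    rw [hdiv x, hdiv y] at h₃
    exact h₃

theorem ent_quotientUnif [Group A] {m : L.Term (Fin 2)}
    (hm : ∀ x y : A, m.realize ![x, y] = x * y) {i : L.Term (Fin 1)}
    (hi : ∀ x : A, i.realize ![x] = x⁻¹) {α : Congruence L A} {U W : CompUnif L A}
    (hC : Centralizes (.ofCongruence α) U W) :
    (quotientUnif hm hi hC).ent = comap (fun p => (p.1.1.1, p.2.1.1)) U.ent ⊓
      comap (fun p => (p.1.1.1⁻¹ * p.1.1.2, p.2.1.1⁻¹ * p.2.1.2)) W.ent :=
  rfl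

theorem commutator'_le_of_centralizes (hA : HasUnderlyingGroup L A) {α : Congruence L A}
    {U W : CompUnif L A} (hC : Centralizes (.ofCongruence α) U W) : commutator' α U ≤ W := by
  obtain ⟨_, ⟨m, hm⟩, ⟨i, hi⟩⟩ := hA
  have hDelta : Delta α U ≤ quotientUnif hm hi hC := by
    refine CompUnif.pushforward_le ?_
    rintro R ⟨V, hV, hVR⟩
    change V ∈ (quotientUnif hm hi hC).ent at hV
    rw [ent_quotientUnif] at hV
    obtain ⟨_, ⟨P, hP, hP'⟩, _, ⟨S, hS, hS'⟩, hPS⟩ := mem_inf_iff_superset.1 hV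
    refine mem_of_superset hP ?_
    rintro ⟨x, y⟩ hxy
    refine hVR (hPS ⟨hP' hxy, hS' ?_⟩)
    change (x⁻¹ * x, y⁻¹ * y) ∈ S
    rw [inv_mul_cancel, inv_mul_cancel]
    exact W.refl_mem_ent hS _
  refine CompUnif.le_of_comap_le_comap (proj₂_surjective α) ?_
  rw [comap_commutator']
  refine sup_le ?_ (CompUnif.ofCongruence_ker_le_comap _ _)
  rintro R ⟨V, hV, hVR⟩
  obtain ⟨S, hS, hmS⟩ := W.exists_forall_realize_mem m V hV
  refine mem_ent_Delta_inf_kerProj₁.2 ⟨_, hDelta (ent_quotientUnif hm hi hC ▸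
    mem_inf_of_right (preimage_mem_comap hS)), fun x y hxy he => hVR ?_⟩
  have := hmS ![x.1.1, x.1.1⁻¹ * x.1.2] ![y.1.1, y.1.1⁻¹ * y.1.2] fun j => by
    fin_cases j
    · change (x.1.1, y.1.1) ∈ S
      rw [he]
      exact W.refl_mem_ent hS _
    · exact hxy
  rw [hm, hm, mul_inv_cancel_left, mul_inv_cancel_left] at this
  exact this

end Groups

end UnifComm

theorem theoremT {L : FirstOrder.Language.{v, w}} [L.IsAlgebraic] {A : Type u} [L.Structure A]
    (α : UnifComm.Congruence L A) (U : UnifComm.CompUnif L A) :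
    (UnifComm.InCongruenceModularVariety L A →
      UnifComm.commutator (UnifComm.CompUnif.ofCongruence α) U ≤ UnifComm.commutator' α U) ∧
    (UnifComm.HasUnderlyingGroup L A →
      UnifComm.commutator (UnifComm.CompUnif.ofCongruence α) U = UnifComm.commutator' α U) := by
  open UnifComm in
  have htriv : ∀ x y : PairAlg α, (Congruence.ker (proj₂ α)).r x y →
      (Congruence.ker (proj₁ α)).r x y → ∀ R ∈ (Delta α U).ent, (x, y) ∈ R := by
    intro x y h₂ h₁ R hR
    rw [show x = y from Subtype.ext (Prod.ext h₁ h₂)]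
    exact (Delta α U).refl_mem_ent hR y
  refine ⟨fun ⟨E, hA, hE⟩ => ?_, fun hA => le_antisymm ?_ ?_⟩
  · exact (isLeast_commutator _ _).2 (centralizes_commutator'
      (shifts_of_congruenceModular (satisfies_pairAlg hA α) hE htriv))
  · obtain ⟨t, h₁, h₂⟩ := exists_malcev hA
    refine (isLeast_commutator _ _).2 (centralizes_commutator' (shifts_of_malcev t
      (fun v hv => ?_) (fun v hv => ?_) htriv))
    · refine Subtype.ext (Prod.ext ?_ ?_)
      · rw [realize_fst, h₁ _ (by rw [hv])]
      · rw [realize_snd, h₁ _ (by rw [hv])]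
    · refine Subtype.ext (Prod.ext ?_ ?_)
      · rw [realize_fst, h₂ _ (by rw [hv])]
      · rw [realize_snd, h₂ _ (by rw [hv])]
  · exact commutator'_le_of_centralizes hA (isLeast_commutator _ _).1
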